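/- Let $R$ be a commutative unital ring that is coherent (every finitely generated ideal is finitely presented) and regular (every finitely generated ideal has finite projective dimension). Call a full subcategory of an abelian category wide if it is a nonempty abelian subcategory (closed under kernels and cokernels) that is closed under extensions, and let $\mathrm{Wide}(R)$ be the intersection of all wide subcategories of the category of $R$-modules that contain $R$. Let $\mathrm{proj}\,R$ be the category of finitely generated projective $R$-modules. Let $D^b(\mathrm{Wide}(R))$ be the bounded derived category of the abelian category $\mathrm{Wide}(R)$, and let $D^b(\mathrm{proj}\,R)$ be the chain homotopy category of perfect complexes, i.e. of bounded complexes of finitely generated projective $R$-modules. For a triangulated category $\mathcal T$, let $K_0(\mathcal T)$ be the free abelian group on the isomorphism classes of objects of $\mathcal T$ modulo the relations $[B]=[A]+[C]$ for all exact triangles $A\to B\to C\to\Sigma A$. Then $\mathrm{Wide}(R)$ consists precisely of the finitely presented $R$-modules, and there is an isomorphism of abelian groups $$K_0\bigl(D^b(\mathrm{Wide}(R))\bigr)\;\cong\;K_0\bigl(D^b(\mathrm{proj}\,R)\bigr).$$ -/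

import Mathlib

open CategoryTheory CategoryTheory.Limits CategoryTheory.Pretriangulated
  ZeroObject

universe w v u

namespace WideK

section Rings

/-- A commutative ring is coherent if every finitely generated ideal is finitely presented. -/
def IsCoherentRing (R : Type u) [CommRing R] : Prop :=
  ∀ I : Ideal R, I.FG → Module.FinitePresentation R I

/-- A commutative ring is regular if every finitely generated ideal has finite projective
dimension. -/
def IsRegularRing (R : Type u) [CommRing R] : Prop :=
  ∀ I : Ideal R, I.FG → ∃ n : ℕ, HasProjectiveDimensionLE (ModuleCat.of R I) n

end Rings

section Wide

variable {A : Type u} [Category.{v} A] [Abelian A]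

/-- A full subcategory of an abelian category (given by a property of objects) is wide if it is a
nonempty abelian subcategory (closed under kernels and cokernels computed in the ambient
category) which is closed under extensions. Closure under isomorphisms and finite direct sums
follows. -/
structure IsWide (P : ObjectProperty A) : Prop where
  nonempty : ∃ X, P X
  kernels : P.IsClosedUnderKernels
  cokernels : P.IsClosedUnderCokernels
  extensions : P.IsClosedUnderExtensions

lemma IsWide.of_iso {P : ObjectProperty A} (h : IsWide P) {X Y : A} (e : X ≅ Y) (hX : P X) :
    P Y := by
  have := h.kernels
  exact P.prop_of_isLimit_kernelFork
    (k := KernelFork.ofι (f := (0 : X ⟶ X)) e.inv (by simp))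
    (KernelFork.IsLimit.ofι _ _ (fun g _ => g ≫ e.hom) (by simp)
      (fun g _ m hm => by simp [← hm])) hX hX

lemma IsWide.prop_of_isZero {P : ObjectProperty A} (h : IsWide P) {X : A} (hX : IsZero X) :
    P X := by
  obtain ⟨Y, hY⟩ := h.nonempty
  have := h.kernels
  exact h.of_iso ((isZero_kernel_of_mono (𝟙 Y)).iso hX) (P.prop_kernel (𝟙 Y) hY hY)

lemma IsWide.prop_biprod {P : ObjectProperty A} (h : IsWide P) {X Y : A} (hX : P X) (hY : P Y) :
    P (X ⊞ Y) := by
  have := h.extensions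
  exact P.prop_biprod hX hY

/-- The wide subcategory generated by an object: the intersection of all wide subcategories
that contain it. -/
def wideGeneratedBy (X : A) : ObjectProperty A :=
  fun Y => ∀ P : ObjectProperty A, IsWide P → P X → P Y

lemma isWide_wideGeneratedBy (X : A) : IsWide (wideGeneratedBy X) where
  nonempty := ⟨X, fun _ _ h => h⟩
  kernels := ⟨by
    rintro _ ⟨f, k, hk, hf⟩ P hP hX
    have := hP.kernels
    exact P.prop_of_isLimit_kernelFork hk (hf.1 P hP hX) (hf.2 P hP hX)⟩
  cokernels := ⟨by
    rintro _ ⟨f, k, hk, hf⟩ P hP hX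
    have := hP.cokernels
    exact P.prop_of_isColimit_cokernelCofork hk (hf.1 P hP hX) (hf.2 P hP hX)⟩
  extensions := ⟨fun hS h₁ h₃ P hP hX => by
    have := hP.extensions
    exact P.prop_X₂_of_shortExact hS (h₁ P hP hX) (h₃ P hP hX)⟩

instance (X : A) : (wideGeneratedBy X).IsClosedUnderKernels := (isWide_wideGeneratedBy X).kernels

instance (X : A) : (wideGeneratedBy X).IsClosedUnderCokernels :=
  (isWide_wideGeneratedBy X).cokernels

instance (X : A) : (wideGeneratedBy X).IsClosedUnderExtensions :=
  (isWide_wideGeneratedBy X).extensions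

instance (X : A) : (wideGeneratedBy X).IsClosedUnderIsomorphisms where
  of_iso e h := (isWide_wideGeneratedBy X).of_iso e h

instance (X : A) : (wideGeneratedBy X).ContainsZero where
  exists_zero := ⟨0, isZero_zero A, (isWide_wideGeneratedBy X).prop_of_isZero (isZero_zero A)⟩

instance (X : A) : (wideGeneratedBy X).IsClosedUnderFiniteProducts := by
  have h := isWide_wideGeneratedBy X
  have h₂ : (wideGeneratedBy X).IsClosedUnderBinaryProducts := ⟨by
    rintro Z ⟨p⟩
    have hp := h.prop_biprod (p.prop_diag_obj ⟨WalkingPair.left⟩)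
      (p.prop_diag_obj ⟨WalkingPair.right⟩)
    refine h.of_iso ?_ hp
    exact (biprod.isoProd _ _) ≪≫
      (HasLimit.isoOfNatIso (diagramIsoPair p.diag)).symm ≪≫
      (limit.isLimit _).conePointUniqueUpToIso p.isLimit⟩
  exact .mk'

end Wide

section Modules

variable (R : Type u) [CommRing R]

/-- `Wide(R)`: the wide subcategory of the category of `R`-modules generated by `R`. -/
abbrev wide : ObjectProperty (ModuleCat.{u} R) := wideGeneratedBy (ModuleCat.of R R)

/-- The category `Wide(R)`. It is abelian, as a wide subcategory. -/
abbrev Wide : Type (u + 1) := (wide R).FullSubcategory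

/-- The property of being a finitely generated projective `R`-module. -/
def fgProj : ObjectProperty (ModuleCat.{u} R) :=
  fun M => Module.Finite R M ∧ Module.Projective R M

/-- `proj R`: the category of finitely generated projective `R`-modules. -/
abbrev FGProj : Type (u + 1) := (fgProj R).FullSubcategory

lemma fgProj_of_iso {M N : ModuleCat.{u} R} (e : M ≅ N) (h : fgProj R M) : fgProj R N := by
  obtain ⟨h₁, h₂⟩ := h
  exact ⟨Module.Finite.equiv e.toLinearEquiv, Module.Projective.of_equiv e.toLinearEquiv⟩

instance : (fgProj R).IsClosedUnderIsomorphisms where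
  of_iso e h := fgProj_of_iso R e h

lemma fgProj_of_isZero {M : ModuleCat.{u} R} (h : IsZero M) : fgProj R M := by
  have := ModuleCat.subsingleton_of_isZero h
  exact ⟨inferInstance, inferInstance⟩

instance : (fgProj R).ContainsZero where
  exists_zero := ⟨0, isZero_zero _, fgProj_of_isZero R (isZero_zero _)⟩

instance : (fgProj R).IsClosedUnderFiniteProducts := by
  have h₂ : (fgProj R).IsClosedUnderBinaryProducts := ⟨by
    rintro Z ⟨p⟩
    obtain ⟨_, _⟩ := p.prop_diag_obj ⟨WalkingPair.left⟩
    obtain ⟨_, _⟩ := p.prop_diag_obj ⟨WalkingPair.right⟩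
    refine fgProj_of_iso R ((ModuleCat.biprodIsoProd _ _).symm ≪≫ (biprod.isoProd _ _) ≪≫
      (HasLimit.isoOfNatIso (diagramIsoPair p.diag)).symm ≪≫
      (limit.isLimit _).conePointUniqueUpToIso p.isLimit) ⟨?_, ?_⟩
    · exact inferInstanceAs (Module.Finite R (_ × _))
    · exact inferInstanceAs (Module.Projective R (_ × _))⟩
  exact .mk'

instance : HasBinaryBiproducts (FGProj R) :=
  HasBinaryBiproducts.of_hasBinaryProducts

end Modules

section BoundedHomotopy

variable (C : Type u) [Category.{v} C] [Preadditive C]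

/-- The property of objects of the homotopy category of cochain complexes whose underlying complex
is bounded, i.e. zero outside of a finite range of degrees. -/
def bounded : ObjectProperty (HomotopyCategory C (ComplexShape.up ℤ)) :=
  fun K => ∃ a b : ℤ, CochainComplex.IsStrictlyGE K.as a ∧ CochainComplex.IsStrictlyLE K.as b

instance [HasZeroObject C] : (bounded C).ContainsZero where
  exists_zero := ⟨(HomotopyCategory.quotient _ _).obj 0, Functor.map_isZero _ (isZero_zero _),
    0, 0, inferInstanceAs (CochainComplex.IsStrictlyGE (0 : CochainComplex C ℤ) 0),
    inferInstanceAs (CochainComplex.IsStrictlyLE (0 : CochainComplex C ℤ) 0)⟩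

instance : (bounded C).IsStableUnderShift ℤ where
  isStableUnderShiftBy n :=
    { le_shift := by
        intro K hK
        obtain ⟨K : CochainComplex _ _, rfl⟩ := K.quotient_obj_surjective
        obtain ⟨a, b, ha, hb⟩ := hK
        replace ha : K.IsStrictlyGE a := ha
        replace hb : K.IsStrictlyLE b := hb
        rw [ObjectProperty.prop_shift_iff, HomotopyCategory.shift_quotient_obj]
        exact ⟨a - n, b - n, K.isStrictlyGE_shift a n (a - n) (by lia),
          K.isStrictlyLE_shift b n (b - n) (by lia)⟩ }

lemma isStrictlyLE_mappingCone [HasBinaryBiproducts C] {K L : CochainComplex C ℤ} (f : K ⟶ L)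
    (n₁ n₂ n : ℤ) [K.IsStrictlyLE n₁] [L.IsStrictlyLE n₂] (hn₁ : n₁ ≤ n + 1) (hn₂ : n₂ ≤ n) :
    (CochainComplex.mappingCone f).IsStrictlyLE n := by
  rw [CochainComplex.isStrictlyLE_iff]
  intro i hi
  simp only [CochainComplex.mappingCone.isZero_X_iff]
  exact ⟨K.isZero_of_isStrictlyLE n₁ _ (by lia), L.isZero_of_isStrictlyLE n₂ _ (by lia)⟩

instance [HasZeroObject C] [HasBinaryBiproducts C] : (bounded C).IsTriangulatedClosed₃ where
  ext₃' T hT h₁ h₂ := by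
    obtain ⟨a₁, b₁, _, _⟩ := h₁
    obtain ⟨a₂, b₂, _, _⟩ := h₂
    obtain ⟨f : T.obj₁.as ⟶ T.obj₂.as, hf⟩ :=
      (HomotopyCategory.quotient _ _).map_surjective T.mor₁
    refine ⟨(HomotopyCategory.quotient _ _).obj (CochainComplex.mappingCone f), ?_,
      ⟨Triangle.π₃.mapIso (isoTriangleOfIso₁₂ T _ hT
        (HomotopyCategory.mappingCone_triangleh_distinguished f)
        (Iso.refl _) (Iso.refl _) ?_)⟩⟩
    · exact ⟨min (a₁ - 1) a₂, max (b₁ - 1) b₂,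
        CochainComplex.isStrictlyGE_mappingCone f a₁ a₂ _ (by simp) (by simp),
        isStrictlyLE_mappingCone C f b₁ b₂ _ (by lia) (by lia)⟩
    · exact (Category.comp_id _).trans (hf.symm.trans (Category.id_comp _).symm)

instance [HasZeroObject C] [HasBinaryBiproducts C] : (bounded C).IsTriangulated where
  toIsTriangulatedClosed₂ := .of_isTriangulatedClosed₃

/-- The bounded homotopy category `K^b(C)` of an additive category `C`: bounded complexes of objects
of `C`, with chain maps up to chain homotopy. For `C = proj R` this is the chain homotopy
category of perfect complexes, i.e. the bounded derived category `D^b(proj R)` (a bounded complex of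
projectives which is exact is contractible, so that quasi-isomorphisms of perfect complexes
are already homotopy equivalences). -/
abbrev BoundedHomotopyCategory : Type (max u v) := (bounded C).FullSubcategory

end BoundedHomotopy

section K0

variable (T : Type u) [Category.{v} T] [HasZeroObject T] [HasShift T ℤ] [Preadditive T]
  [∀ n : ℤ, (shiftFunctor T n).Additive] [Pretriangulated T]

variable {T} in
/-- The basis element of the free abelian group on isomorphism classes of objects. -/
def isoClass (X : T) : FreeAbelianGroup (Quotient (isIsomorphicSetoid T)) :=
  FreeAbelianGroup.of (Quotient.mk (isIsomorphicSetoid T) X)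

/-- The subgroup generated by the Euler relations `[B] = [A] + [C]`, for all exact triangles
`A ⟶ B ⟶ C ⟶ A⟦1⟧`. -/
def eulerRelations : AddSubgroup (FreeAbelianGroup (Quotient (isIsomorphicSetoid T))) :=
  AddSubgroup.closure
    {x | ∃ S ∈ distTriang T, x = isoClass S.obj₂ - (isoClass S.obj₁ + isoClass S.obj₃)}

/-- The Grothendieck group of a triangulated category: the free abelian group on isomorphism
classes of objects modulo the Euler relations. -/
abbrev K₀ : Type u := FreeAbelianGroup (Quotient (isIsomorphicSetoid T)) ⧸ eulerRelations T

end K0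

end WideK

namespace WideK

section Coherent

variable {R : Type u} [CommRing R]

/-- A module `M` has finite projective dimension. -/
def HasFinitePD (R : Type u) [CommRing R] (M : Type u) [AddCommGroup M] [Module R M] : Prop :=
  ∃ n : ℕ, HasProjectiveDimensionLE (ModuleCat.of R M) n

lemma hasFinitePD_of_projective (M : Type u) [AddCommGroup M] [Module R M]
    [Module.Projective R M] : HasFinitePD R M :=
  ⟨0, (projective_iff_hasProjectiveDimensionLE_zero _).1 inferInstance⟩

lemma hasFinitePD_of_ker {M N : Type u} [AddCommGroup M] [Module R M] [AddCommGroup N]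
    [Module R N] (f : M →ₗ[R] N) (hf : Function.Surjective f)
    (hK : HasFinitePD R (LinearMap.ker f)) (hN : HasFinitePD R N) : HasFinitePD R M := by
  obtain ⟨a, ha⟩ := hK
  obtain ⟨b, hb⟩ := hN
  have hS := LinearMap.shortExact_shortComplexKer hf
  exact ⟨max a b, hS.hasProjectiveDimensionLT_X₂ _
    (hasProjectiveDimensionLT_of_ge _ (a + 1) _ (by lia))
    (hasProjectiveDimensionLT_of_ge _ (b + 1) _ (by lia))⟩

lemma hasFinitePD_of_surjective {M N : Type u} [AddCommGroup M] [Module R M] [AddCommGroup N]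
    [Module R N] (f : M →ₗ[R] N) (hf : Function.Surjective f)
    (hK : HasFinitePD R (LinearMap.ker f)) (hM : HasFinitePD R M) : HasFinitePD R N := by
  obtain ⟨a, ha⟩ := hK
  obtain ⟨b, hb⟩ := hM
  have hS := LinearMap.shortExact_shortComplexKer hf
  exact ⟨max a b + 1, hS.hasProjectiveDimensionLT_X₃ _
    (hasProjectiveDimensionLT_of_ge _ (a + 1) (max a b + 1) (by lia))
    (hasProjectiveDimensionLT_of_ge _ (b + 1) _ (by lia))⟩

/-- Over a coherent ring, finitely generated submodules of `Rⁿ` are finitely presented, and if the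
ring is moreover regular, they have finite projective dimension. -/
lemma finitePresentation_of_injective_pi (hcoh : IsCoherentRing R) (n : ℕ) :
    ∀ (M : Type u) [AddCommGroup M] [Module R M] [Module.Finite R M] (g : M →ₗ[R] (Fin n → R)),
      Function.Injective g →
      Module.FinitePresentation R M ∧ (IsRegularRing R → HasFinitePD R M) := by
  induction n with
  | zero =>
    intro M _ _ _ g hg
    have : Subsingleton M := hg.subsingleton
    exact ⟨inferInstance, fun _ => hasFinitePD_of_projective M⟩
  | succ n ih =>
    intro M _ _ _ g hg
    let p : M →ₗ[R] R := LinearMap.proj 0 ∘ₗ g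
    let q := p.rangeRestrict
    have hq : Function.Surjective q := p.surjective_rangeRestrict
    have hI : (LinearMap.range p).FG := by
      rw [LinearMap.range_eq_map]
      exact Module.Finite.fg_top.map p
    have hI' : Module.FinitePresentation R (LinearMap.range p) := hcoh _ hI
    have : Module.Finite R (LinearMap.ker q) :=
      Module.Finite.iff_fg.2 (Module.FinitePresentation.fg_ker q hq)
    let t : LinearMap.ker q →ₗ[R] (Fin n → R) :=
      LinearMap.funLeft R R Fin.succ ∘ₗ g ∘ₗ (LinearMap.ker q).subtype
    have ht : Function.Injective t := by
      rw [← LinearMap.ker_eq_bot, LinearMap.ker_eq_bot']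
      rintro ⟨m, hm⟩ h
      have h0 : g m 0 = 0 := congrArg Subtype.val (LinearMap.mem_ker.1 hm)
      have h1 : g m = 0 := by
        funext i
        refine Fin.cases h0 (fun i => ?_) i
        exact congrFun h i
      exact Subtype.ext (hg (h1.trans (map_zero g).symm))
    obtain ⟨h1, h2⟩ := ih _ t ht
    exact ⟨Module.finitePresentation_of_ker q hq,
      fun hreg => hasFinitePD_of_ker q hq (h2 hreg) (hreg _ hI)⟩

lemma hasFinitePD_of_finitePresentation (hcoh : IsCoherentRing R) (hreg : IsRegularRing R)
    (M : Type u) [AddCommGroup M] [Module R M] [Module.FinitePresentation R M] :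
    HasFinitePD R M := by
  obtain ⟨n, g, hg⟩ := Module.Finite.exists_fin' R M
  have : Module.Finite R (LinearMap.ker g) :=
    Module.Finite.iff_fg.2 (Module.FinitePresentation.fg_ker g hg)
  exact hasFinitePD_of_surjective g hg
    ((finitePresentation_of_injective_pi hcoh n _ (LinearMap.ker g).subtype
      Subtype.val_injective).2 hreg) (hasFinitePD_of_projective _)

lemma finitePresentation_of_fg_submodule (hcoh : IsCoherentRing R)
    {M : Type u} [AddCommGroup M] [Module R M] [Module.FinitePresentation R M]
    (N : Submodule R M) (hN : N.FG) : Module.FinitePresentation R N := by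
  obtain ⟨n, g, hg⟩ := Module.Finite.exists_fin' R M
  have hK : (LinearMap.ker g).FG := Module.FinitePresentation.fg_ker g hg
  have hL : (N.comap g).FG := by
    refine Submodule.fg_of_fg_map_of_fg_inf_ker g ?_ ?_
    · rwa [Submodule.map_comap_eq_of_surjective hg]
    · rwa [inf_eq_right.2 (LinearMap.ker_le_comap g)]
  have : Module.Finite R (N.comap g) := Module.Finite.iff_fg.2 hL
  have := (finitePresentation_of_injective_pi hcoh n _ (N.comap g).subtype
    Subtype.val_injective).1
  let r : N.comap g →ₗ[R] N := g.restrict (fun _ h => h)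
  refine Module.finitePresentation_of_surjective r ?_ ?_
  · rintro ⟨x, hx⟩
    obtain ⟨y, rfl⟩ := hg x
    exact ⟨⟨y, hx⟩, rfl⟩
  · have : LinearMap.ker r = (LinearMap.ker g).comap (N.comap g).subtype := by
      ext x
      simp [r, Subtype.ext_iff]
    rw [this]
    exact (Submodule.fg_map_iff _ Subtype.val_injective).1
      (by rwa [Submodule.map_comap_subtype, inf_eq_right.2 (LinearMap.ker_le_comap g)])

lemma finitePresentation_ker (hcoh : IsCoherentRing R)
    {M N : Type u} [AddCommGroup M] [Module R M] [AddCommGroup N] [Module R N]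
    [Module.FinitePresentation R M] [Module.FinitePresentation R N] (f : M →ₗ[R] N) :
    Module.FinitePresentation R (LinearMap.ker f) := by
  have hI : (LinearMap.range f).FG := by
    rw [LinearMap.range_eq_map]
    exact Module.Finite.fg_top.map f
  have := finitePresentation_of_fg_submodule hcoh _ hI
  have h := Module.FinitePresentation.fg_ker f.rangeRestrict f.surjective_rangeRestrict
  rw [LinearMap.ker_rangeRestrict] at h
  exact finitePresentation_of_fg_submodule hcoh _ h

variable (R) in
/-- The property of being a finitely presented `R`-module. -/
def finPres : ObjectProperty (ModuleCat.{u} R) := fun M => Module.FinitePresentation R M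

lemma finPres_of_iso {M N : ModuleCat.{u} R} (e : M ≅ N) (h : finPres R M) : finPres R N :=
  have : Module.FinitePresentation R M := h
  Module.FinitePresentation.of_equiv e.toLinearEquiv

lemma isWide_finPres (hcoh : IsCoherentRing R) : IsWide (finPres R) where
  nonempty := ⟨ModuleCat.of R R, inferInstanceAs (Module.FinitePresentation R R)⟩
  kernels := ⟨by
    rintro _ ⟨f, k, hk, hf⟩
    have : Module.FinitePresentation R _ := hf.1
    have : Module.FinitePresentation R _ := hf.2
    exact finPres_of_iso ((ModuleCat.kernelIsLimit f).conePointUniqueUpToIso hk)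
      (finitePresentation_ker hcoh f.hom)⟩
  cokernels := ⟨by
    rintro _ ⟨f, k, hk, hf⟩
    have : Module.FinitePresentation R _ := hf.1
    have : Module.FinitePresentation R _ := hf.2
    have h : (LinearMap.range f.hom).mkQ.ker.FG := by
      rw [Submodule.ker_mkQ, LinearMap.range_eq_map]
      exact Module.Finite.fg_top.map f.hom
    exact finPres_of_iso ((ModuleCat.cokernelIsColimit f).coconePointUniqueUpToIso hk)
      (Module.finitePresentation_of_surjective _ (Submodule.mkQ_surjective _) h)⟩
  extensions := ⟨by
    intro S hS h₁ h₃
    have : Module.FinitePresentation R S.X₃ := h₃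
    have : Module.FinitePresentation R (LinearMap.ker S.g.hom) := by
      rw [← hS.exact.moduleCat_range_eq_ker]
      have : Module.FinitePresentation R S.X₁ := h₁
      exact Module.FinitePresentation.of_equiv
        (LinearEquiv.ofInjective S.f.hom hS.moduleCat_injective_f)
    exact Module.finitePresentation_of_ker S.g.hom hS.moduleCat_surjective_g⟩

variable (R) in
lemma wide_pi (n : ℕ) : wide R (ModuleCat.of R (Fin n → R)) := by
  have h : wide R (∏ᶜ fun _ : Fin n => ModuleCat.of R R) :=
    (wide R).prop_product fun _ _ _ h => h
  exact (wide R).prop_of_iso (ModuleCat.piIsoPi.{u, 0} _) h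

lemma wide_of_finPres {M : ModuleCat.{u} R} (hM : finPres R M) : wide R M := by
  have : Module.FinitePresentation R M := hM
  obtain ⟨n, m, f, g, hf, hfg⟩ := Module.FinitePresentation.exists_fin' R M
  exact (wide R).prop_of_isColimit_cokernelCofork
    (ModuleCat.isColimitCokernelCofork (ModuleCat.ofHom g) (ModuleCat.ofHom f) hfg hf)
    (wide_pi R m) (wide_pi R n)

lemma wide_iff_finPres (hcoh : IsCoherentRing R) (M : ModuleCat.{u} R) :
    wide R M ↔ Module.FinitePresentation R M :=
  ⟨fun h => h _ (isWide_finPres hcoh) (inferInstanceAs (Module.FinitePresentation R R)),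
    wide_of_finPres⟩

end Coherent

section K0

universe v₁ v₂ u₁ u₂

variable {T₁ : Type u₁} [Category.{v₁} T₁] [HasZeroObject T₁] [HasShift T₁ ℤ] [Preadditive T₁]
  [∀ n : ℤ, (shiftFunctor T₁ n).Additive] [Pretriangulated T₁]
  {T₂ : Type u₂} [Category.{v₂} T₂] [HasZeroObject T₂] [HasShift T₂ ℤ] [Preadditive T₂]
  [∀ n : ℤ, (shiftFunctor T₂ n).Additive] [Pretriangulated T₂]

/-- The class of an object in the Grothendieck group. -/
def K₀.mk (X : T₁) : K₀ T₁ := QuotientAddGroup.mk (isoClass X)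

lemma K₀.mk_eq_of_iso {X Y : T₁} (e : X ≅ Y) : K₀.mk X = K₀.mk Y :=
  congrArg (fun q => (QuotientAddGroup.mk (FreeAbelianGroup.of q) : K₀ T₁))
    (Quotient.sound ⟨e⟩)

lemma K₀.mk_obj₂ {T : Triangle T₁} (hT : T ∈ distTriang T₁) :
    K₀.mk T.obj₂ = K₀.mk T.obj₁ + K₀.mk T.obj₃ := by
  refine ((QuotientAddGroup.eq_iff_sub_mem (N := eulerRelations T₁)).2 ?_ :
    (QuotientAddGroup.mk (isoClass T.obj₂) : K₀ T₁) =
      QuotientAddGroup.mk (isoClass T.obj₁ + isoClass T.obj₃))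
  exact AddSubgroup.subset_closure ⟨T, hT, rfl⟩

/-- The universal property of the Grothendieck group. -/
def K₀.lift {G : Type*} [AddCommGroup G] (φ : T₁ → G)
    (hiso : ∀ X Y : T₁, (X ≅ Y) → φ X = φ Y)
    (hadd : ∀ T ∈ distTriang T₁, φ T.obj₂ = φ T.obj₁ + φ T.obj₃) : K₀ T₁ →+ G :=
  QuotientAddGroup.lift _
    (FreeAbelianGroup.lift (Quotient.lift φ fun X Y ⟨e⟩ => hiso X Y e)) (by
      refine (AddSubgroup.closure_le _).2 ?_
      rintro _ ⟨T, hT, rfl⟩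
      change FreeAbelianGroup.lift _ _ = 0
      rw [map_sub, map_add]
      simp only [isoClass, FreeAbelianGroup.lift_apply_of]
      exact sub_eq_zero.2 (hadd T hT))

lemma K₀.lift_mk {G : Type*} [AddCommGroup G] (φ : T₁ → G)
    (hiso : ∀ X Y : T₁, (X ≅ Y) → φ X = φ Y)
    (hadd : ∀ T ∈ distTriang T₁, φ T.obj₂ = φ T.obj₁ + φ T.obj₃) (X : T₁) :
    K₀.lift φ hiso hadd (K₀.mk X) = φ X :=
  FreeAbelianGroup.lift_apply_of _ _

lemma K₀.hom_ext {G : Type*} [AddCommGroup G] {f g : K₀ T₁ →+ G}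
    (h : ∀ X : T₁, f (K₀.mk X) = g (K₀.mk X)) : f = g := by
  refine QuotientAddGroup.addMonoidHom_ext _ (FreeAbelianGroup.lift_ext _ _ fun q => ?_)
  induction q using Quotient.inductionOn with
  | h X => exact h X

/-- The homomorphism of Grothendieck groups that is induced by a triangulated functor. -/
def K₀.map (F : T₁ ⥤ T₂) [F.CommShift ℤ] [F.IsTriangulated] : K₀ T₁ →+ K₀ T₂ :=
  K₀.lift (fun X => K₀.mk (F.obj X)) (fun _ _ e => K₀.mk_eq_of_iso (F.mapIso e))
    (fun _ hT => K₀.mk_obj₂ (F.map_distinguished _ hT))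

lemma K₀.map_mk (F : T₁ ⥤ T₂) [F.CommShift ℤ] [F.IsTriangulated] (X : T₁) :
    K₀.map F (K₀.mk X) = K₀.mk (F.obj X) :=
  K₀.lift_mk _ _ _ X

lemma K₀.mk_objPreimage_obj₂ (F : T₁ ⥤ T₂) [F.CommShift ℤ] [F.IsTriangulated]
    [F.IsEquivalence] {T : Triangle T₂} (hT : T ∈ distTriang T₂) :
    K₀.mk (F.objPreimage T.obj₂) = K₀.mk (F.objPreimage T.obj₁) + K₀.mk (F.objPreimage T.obj₃) := by
  obtain ⟨T', hT', ⟨e⟩⟩ := F.mem_mapTriangle_essImage_of_distinguished T hT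
  let e₁ : F.obj T'.obj₁ ≅ T.obj₁ := Triangle.π₁.mapIso e
  let e₂ : F.obj T'.obj₂ ≅ T.obj₂ := Triangle.π₂.mapIso e
  let e₃ : F.obj T'.obj₃ ≅ T.obj₃ := Triangle.π₃.mapIso e
  rw [K₀.mk_eq_of_iso (F.preimageIso (F.objObjPreimageIso T.obj₁ ≪≫ e₁.symm)),
    K₀.mk_eq_of_iso (F.preimageIso (F.objObjPreimageIso T.obj₂ ≪≫ e₂.symm)),
    K₀.mk_eq_of_iso (F.preimageIso (F.objObjPreimageIso T.obj₃ ≪≫ e₃.symm)), K₀.mk_obj₂ hT']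

/-- The inverse of the homomorphism of Grothendieck groups that is induced by a triangulated
equivalence. -/
noncomputable def K₀.mapInv (F : T₁ ⥤ T₂) [F.CommShift ℤ] [F.IsTriangulated]
    [F.IsEquivalence] : K₀ T₂ →+ K₀ T₁ :=
  K₀.lift (fun Y => K₀.mk (F.objPreimage Y))
    (fun Y Y' e => K₀.mk_eq_of_iso (F.preimageIso
      (F.objObjPreimageIso Y ≪≫ e ≪≫ (F.objObjPreimageIso Y').symm)))
    (fun _ hT => K₀.mk_objPreimage_obj₂ F hT)

lemma K₀.mapInv_mk (F : T₁ ⥤ T₂) [F.CommShift ℤ] [F.IsTriangulated] [F.IsEquivalence] (Y : T₂) :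
    K₀.mapInv F (K₀.mk Y) = K₀.mk (F.objPreimage Y) :=
  K₀.lift_mk _ _ _ Y

/-- A triangulated equivalence induces an isomorphism of Grothendieck groups. -/
noncomputable def K₀.equivOfIsEquivalence (F : T₁ ⥤ T₂) [F.CommShift ℤ] [F.IsTriangulated]
    [F.IsEquivalence] : K₀ T₁ ≃+ K₀ T₂ :=
  AddMonoidHom.toAddEquiv (K₀.map F) (K₀.mapInv F)
    (K₀.hom_ext fun X => by
      rw [AddMonoidHom.comp_apply, K₀.map_mk, K₀.mapInv_mk]
      exact K₀.mk_eq_of_iso (F.preimageIso (F.objObjPreimageIso (F.obj X))))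
    (K₀.hom_ext fun Y => by
      rw [AddMonoidHom.comp_apply, K₀.mapInv_mk, K₀.map_mk]
      exact K₀.mk_eq_of_iso (F.objObjPreimageIso Y))

end K0

section Bounded

variable {A : Type u} [Category.{v} A] [Abelian A] [HasDerivedCategory.{w} A]

/-- A triangulated subcategory of the derived category which contains the complexes concentrated
in degree zero contains all bounded objects. -/
lemma bounded_le_of_singleFunctor (P : ObjectProperty (DerivedCategory A))
    [P.IsTriangulated] [P.IsClosedUnderIsomorphisms]
    (h : ∀ M : A, P ((DerivedCategory.singleFunctor A 0).obj M)) :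
    DerivedCategory.TStructure.t.bounded ≤ P := by
  have h' (a : ℤ) (X : DerivedCategory A) [X.IsGE a] [X.IsLE a] : P X := by
    obtain ⟨M, ⟨e⟩⟩ := X.exists_iso_singleFunctor_obj_of_isGE_of_isLE a
    exact P.prop_of_iso
      (((DerivedCategory.singleFunctors A).shiftIso (-a) a 0 (by lia)).app M ≪≫ e.symm)
      (P.le_shift (-a) _ (h M))
  have key (n : ℕ) : ∀ (a : ℤ) (X : DerivedCategory A) [X.IsGE a] [X.IsLE (a + n)], P X := by
    induction n with
    | zero =>
      intro a X _ hX
      rw [Nat.cast_zero, add_zero] at hX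
      exact h' a X
    | succ n ih =>
      intro a X _ hX
      refine P.ext_of_isTriangulatedClosed₂ _
        (DerivedCategory.TStructure.t.triangleLTGE_distinguished (a + 1) X) ?_ ?_
      · have : ((DerivedCategory.TStructure.t.truncLT (a + 1)).obj X).IsLE a :=
          DerivedCategory.TStructure.t.isLE_truncLT_obj _ _ _ (by lia)
        exact h' a ((DerivedCategory.TStructure.t.truncLT (a + 1)).obj X)
      · have : X.IsLE (a + 1 + n) := by
          convert hX using 1
          push_cast
          ring
        exact ih (a + 1) ((DerivedCategory.TStructure.t.truncGE (a + 1)).obj X)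
  rintro X ⟨⟨a, _⟩, ⟨b, hb⟩⟩
  have : X.IsLE (a + (b - a).toNat) :=
    DerivedCategory.TStructure.t.isLE_of_le X b _ (by lia)
  exact key (b - a).toNat a X

end Bounded

section Comparison

variable (R : Type u) [CommRing R]

lemma fgProj_le_wide : fgProj R ≤ wide R := fun M ⟨_, _⟩ =>
  wide_of_finPres (Module.finitePresentation_of_projective R M)

/-- The inclusion of the finitely generated projective modules in `Wide(R)`. -/
abbrev fgProjToWide : FGProj R ⥤ Wide R := ObjectProperty.ιOfLE (fgProj_le_wide R)

instance : (fgProjToWide R).Additive where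

instance : (wide R).ι.PreservesEpimorphisms :=
  (wide R).preservesEpimorphisms_ι_of_isNormalMonoCategory

instance (P : FGProj R) : Projective ((fgProjToWide R).obj P) where
  factors {E X} f e _ := by
    have : Epi e.hom := inferInstanceAs (Epi ((wide R).ι.map e))
    have : Projective ((fgProjToWide R).obj P).obj :=
      (IsProjective.iff_projective P.obj).1 P.property.2
    exact ⟨ObjectProperty.homMk (Projective.factorThru f.hom e.hom), by
      ext : 1
      exact Projective.factorThru_comp f.hom e.hom⟩

lemma isKProjective_map (K : CochainComplex (FGProj R) ℤ) (b : ℤ) [K.IsStrictlyLE b] :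
    CochainComplex.IsKProjective
      (((fgProjToWide R).mapHomologicalComplex (ComplexShape.up ℤ)).obj K) := by
  have : CochainComplex.IsStrictlyLE
      (((fgProjToWide R).mapHomologicalComplex (ComplexShape.up ℤ)).obj K) b := inferInstance
  have (n : ℤ) : Projective ((((fgProjToWide R).mapHomologicalComplex
    (ComplexShape.up ℤ)).obj K).X n) := inferInstanceAs (Projective ((fgProjToWide R).obj (K.X n)))
  exact CochainComplex.isKProjective_of_projective _ b

variable [HasDerivedCategory.{w} (Wide R)]

/-- The functor from the homotopy category of perfect complexes to the derived category
of `Wide(R)`. -/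
noncomputable abbrev perfToDerived :
    BoundedHomotopyCategory (FGProj R) ⥤ DerivedCategory (Wide R) :=
  ((bounded (FGProj R)).ι ⋙ (fgProjToWide R).mapHomotopyCategory (ComplexShape.up ℤ)) ⋙
    DerivedCategory.Qh

lemma Qh_map_bijective (X : BoundedHomotopyCategory (FGProj R))
    (L : HomotopyCategory (Wide R) (ComplexShape.up ℤ)) :
    Function.Bijective (DerivedCategory.Qh.map :
      (((fgProjToWide R).mapHomotopyCategory (ComplexShape.up ℤ)).obj X.obj ⟶ L) → _) := by
  obtain ⟨a, b, ha, hb⟩ := X.property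
  have := isKProjective_map R X.obj.as b
  exact CochainComplex.IsKProjective.Qh_map_bijective
    (((fgProjToWide R).mapHomologicalComplex (ComplexShape.up ℤ)).obj X.obj.as) L

instance : (perfToDerived R).Full where
  map_surjective f := by
    obtain ⟨g, rfl⟩ := (Qh_map_bijective R _ _).surjective f
    obtain ⟨h, rfl⟩ := ((bounded (FGProj R)).ι ⋙
      (fgProjToWide R).mapHomotopyCategory (ComplexShape.up ℤ)).map_surjective g
    exact ⟨h, rfl⟩

instance : (perfToDerived R).Faithful where
  map_injective h :=
    ((bounded (FGProj R)).ι ⋙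
      (fgProjToWide R).mapHomotopyCategory (ComplexShape.up ℤ)).map_injective
      ((Qh_map_bijective R _ _).injective h)

lemma bounded_perfToDerived (X : BoundedHomotopyCategory (FGProj R)) :
    DerivedCategory.TStructure.t.bounded ((perfToDerived R).obj X) := by
  obtain ⟨a, b, ha, hb⟩ := X.property
  let K := ((fgProjToWide R).mapHomologicalComplex (ComplexShape.up ℤ)).obj X.obj.as
  have : CochainComplex.IsStrictlyGE K a := inferInstance
  have : CochainComplex.IsStrictlyLE K b := inferInstance
  let e : (perfToDerived R).obj X ≅ DerivedCategory.Q.obj K :=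
    (DerivedCategory.quotientCompQhIso (Wide R)).app K
  exact ⟨⟨a, ⟨K, e, inferInstance⟩⟩, ⟨b, ⟨K, e, inferInstance⟩⟩⟩

/-- The functor from the homotopy category of perfect complexes to the bounded derived category
of `Wide(R)`. -/
noncomputable abbrev perfToBounded :
    BoundedHomotopyCategory (FGProj R) ⥤ DerivedCategory.Bounded (Wide R) :=
  DerivedCategory.TStructure.t.bounded.lift (perfToDerived R) (bounded_perfToDerived R)

lemma essImage_single_of_fgProj (P : FGProj R) :
    (perfToDerived R).essImage
      ((DerivedCategory.singleFunctor _ 0).obj ((fgProjToWide R).obj P)) := by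
  let K := (CochainComplex.singleFunctor (FGProj R) 0).obj P
  refine ⟨⟨(HomotopyCategory.quotient _ _).obj K, 0, 0,
    inferInstanceAs (CochainComplex.IsStrictlyGE K 0),
    inferInstanceAs (CochainComplex.IsStrictlyLE K 0)⟩, ⟨?_⟩⟩
  exact (DerivedCategory.quotientCompQhIso (Wide R)).app
    (((fgProjToWide R).mapHomologicalComplex (ComplexShape.up ℤ)).obj K) ≪≫
    DerivedCategory.Q.mapIso
      ((HomologicalComplex.singleMapHomologicalComplex (fgProjToWide R)
        (ComplexShape.up ℤ) 0).app P)

lemma essImage_single_of_hasProjectiveDimensionLE (hcoh : IsCoherentRing R) (n : ℕ) :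
    ∀ (M : Wide R), HasProjectiveDimensionLE M.obj n →
      (perfToDerived R).essImage ((DerivedCategory.singleFunctor _ 0).obj M) := by
  induction n with
  | zero =>
    intro M hM
    have hfp := (wide_iff_finPres hcoh _).1 M.property
    have : Projective M.obj := (projective_iff_hasProjectiveDimensionLE_zero _).2 hM
    exact essImage_single_of_fgProj R
      ⟨M.obj, inferInstance, (IsProjective.iff_projective M.obj).2 this⟩
  | succ n ih =>
    intro M hM
    have hfp := (wide_iff_finPres hcoh _).1 M.property
    obtain ⟨m, g, hg⟩ := Module.Finite.exists_fin' R M.obj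
    have hS := LinearMap.shortExact_shortComplexKer hg
    let F : Wide R := ⟨ModuleCat.of R (Fin m → R), wide_pi R m⟩
    let K : Wide R := ⟨ModuleCat.of R (LinearMap.ker g),
      wide_of_finPres (finitePresentation_ker hcoh g)⟩
    let S : ShortComplex (Wide R) :=
      { X₁ := K
        X₂ := F
        X₃ := M
        f := ObjectProperty.homMk (ModuleCat.ofHom (LinearMap.ker g).subtype)
        g := ObjectProperty.homMk (ModuleCat.ofHom g)
        zero := by
          ext : 1
          exact g.shortComplexKer.zero }
    have hS' : S.ShortExact :=
      CategoryTheory.ShortExact.reflects_shortExact_of_faithful (wide R).ι hS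
    have : Projective (ModuleCat.of R (Fin m → R)) :=
      (IsProjective.iff_projective (Fin m → R)).1 inferInstance
    have : HasProjectiveDimensionLT (ModuleCat.of R (Fin m → R)) (n + 1) :=
      hasProjectiveDimensionLT_of_ge _ 1 _ (by lia)
    have hK : HasProjectiveDimensionLE K.obj n :=
      hS.hasProjectiveDimensionLT_X₁ (n + 1) this hM
    exact (perfToDerived R).essImage.ext_of_isTriangulatedClosed₃ _
      hS'.singleTriangle_distinguished (ih K hK)
      (essImage_single_of_fgProj R ⟨ModuleCat.of R (Fin m → R), inferInstance, inferInstance⟩)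

lemma bounded_le_essImage (hcoh : IsCoherentRing R) (hreg : IsRegularRing R) :
    DerivedCategory.TStructure.t.bounded ≤ (perfToDerived R).essImage := by
  refine bounded_le_of_singleFunctor _ fun M => ?_
  have := (wide_iff_finPres hcoh _).1 M.property
  obtain ⟨n, hn⟩ := hasFinitePD_of_finitePresentation hcoh hreg M.obj
  exact essImage_single_of_hasProjectiveDimensionLE R hcoh n M hn

lemma isEquivalence_perfToBounded (hcoh : IsCoherentRing R) (hreg : IsRegularRing R) :
    (perfToBounded R).IsEquivalence where
  essSurj := ⟨fun X => by
    obtain ⟨K, ⟨e⟩⟩ := bounded_le_essImage R hcoh hreg X.obj X.property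
    exact ⟨K, ⟨ObjectProperty.isoMk _ e⟩⟩⟩

end Comparison

end WideK

theorem corollary3p4 (R : Type u) [CommRing R]
    (hcoh : WideK.IsCoherentRing R) (hreg : WideK.IsRegularRing R)
    [HasDerivedCategory.{w} (WideK.Wide R)] :
    (∀ M : ModuleCat.{u} R, WideK.wide R M ↔ Module.FinitePresentation R M) ∧
    Nonempty (WideK.K₀ (DerivedCategory.Bounded (WideK.Wide R)) ≃+
      WideK.K₀ (WideK.BoundedHomotopyCategory (WideK.FGProj R))) := by
  have := WideK.isEquivalence_perfToBounded R hcoh hreg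
  exact ⟨WideK.wide_iff_finPres hcoh,
    ⟨(WideK.K₀.equivOfIsEquivalence (WideK.perfToBounded R)).symm⟩⟩
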